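/- Let $N>2$ and let $\Omega\subset\mathbb R^N$ be a bounded domain (nonempty, open, connected) with smooth boundary $\partial\Omega$ and surface measure $\sigma$. Let $a$ and $b$ be non-negative measurable functions on $\Omega$ and $\partial\Omega$, respectively, with $$\int_\Omega a\,dx+\int_{\partial\Omega} b\,d\sigma>0 .$$ For $r>1$ put $$\mathscr W_r=\Big\{u\in W^{1,r}(\Omega):\int_\Omega a u\,dx+\int_{\partial\Omega} b u\,d\sigma=0\Big\},$$ where the values of $u$ on $\partial\Omega$ are understood in the sense of traces, and define $$\nu_1(r)=\inf_{u\in\mathscr W_r\setminus\{0\}}\frac{\int_\Omega|\nabla u|^2\,dx}{\int_\Omega a u^2\,dx+\int_{\partial\Omega} b u^2\,d\sigma}.$$ For $p>1$ define $$\lambda_1(p)=\inf_{u\in\mathscr W_p\setminus\{0\}}\frac{\frac1p\int_\Omega|\nabla u|^p\,dx+\frac12\int_\Omega|\nabla u|^2\,dx}{\frac12\int_\Omega a u^2\,dx+\frac12\int_{\partial\Omega} b u^2\,d\sigma}, \qquad \mu_1(p)=\inf_{u\in\mathscr W_2\setminus\{0\}}\frac{\frac1p\int_\Omega|\nabla u|^p\,dx+\frac12\int_\Omega|\nabla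 u|^2\,dx}{\frac12\int_\Omega a u^2\,dx+\frac12\int_{\partial\Omega} b u^2\,d\sigma}.$$ Quotients take values in $[0,\infty]$; a quotient with positive numerator and zero denominator is $+\infty$. (i) If $p>2$, $a\in L^{N/2}(\Omega)$ and $b\in L^{N-1}(\partial\Omega)$, then $\lambda_1(p)=\nu_1(p)$. (ii) If $1<p<2$ and one of the following holds: (A) $\frac{2N}{N+1}<p<2$, $a\in L^{\frac{pN}{(p-2)N+2p}}(\Omega)$ and $b\in L^{\frac{p(N-1)}{(p-2)N+p}}(\partial\Omega)$; (B) $\frac{2N}{N+2}<p\le\frac{2N}{N+1}$, $a\in L^{\frac{pN}{(p-2)N+2p}}(\Omega)$ and $b\in L^\infty(\partial\Omega)$; (C) $1<p\le\frac{2N}{N+2}$, $a\in L^\infty(\Omega)$ and $b\in L^\infty(\partial\Omega)$; then $\mu_1(p)=\nu_1$, where $\nu_1:=\nu_1(2)$; the right-hand side does not involve $p$. -/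

import Mathlib

open MeasureTheory Filter Topology Set
open scoped ENNReal ContDiff Gradient

noncomputable section

namespace P2Laplacian

/-- `ℝ^N` with its Euclidean norm. -/
abbrev Rn (N : ℕ) : Type := EuclideanSpace ℝ (Fin N)

variable {N : ℕ}

/-- A bounded domain (nonempty, connected, open) with smooth boundary: near each boundary point,
`Ω` is the set where a smooth function with nonvanishing gradient is negative. -/
structure IsSmoothBoundedDomain (Ω : Set (Rn N)) : Prop where
  isOpen : IsOpen Ω
  isConnected : IsConnected Ω
  isBounded : Bornology.IsBounded Ω
  smooth_boundary : ∀ x₀ ∈ frontier Ω, ∃ U : Set (Rn N), IsOpen U ∧ x₀ ∈ U ∧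
    ∃ ρ : Rn N → ℝ, ContDiffOn ℝ ∞ ρ U ∧ ∇ ρ x₀ ≠ 0 ∧ Ω ∩ U = {x ∈ U | ρ x < 0}

/-- Surface measure `σ` on `∂Ω`: the restriction to `∂Ω` of the `(N-1)`-dimensional Hausdorff
measure, normalized to agree with Lebesgue measure on `(N-1)`-dimensional Euclidean spaces. -/
def surfaceMeasure (Ω : Set (Rn N)) : Measure (Rn N) :=
  (Measure.euclideanHausdorffMeasure (N - 1)).restrict (frontier Ω)

/-- `G` is the weak gradient of `u` in `Ω`: `∫_Ω u ∇φ = -∫_Ω φ G` for all `φ ∈ C_c^∞(Ω)`. -/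
structure IsWeakGradient (Ω : Set (Rn N)) (u : Rn N → ℝ) (G : Rn N → Rn N) : Prop where
  locallyIntegrable : LocallyIntegrableOn u Ω
  locallyIntegrable_grad : LocallyIntegrableOn G Ω
  integral_eq : ∀ φ : Rn N → ℝ, ContDiff ℝ ∞ φ → HasCompactSupport φ → tsupport φ ⊆ Ω →
    ∫ x in Ω, u x • ∇ φ x = -∫ x in Ω, φ x • G x

open Classical in
/-- The weak gradient of `u` in `Ω`, which is unique up to null sets (and `0` if there is none). -/
def weakGrad (Ω : Set (Rn N)) (u : Rn N → ℝ) : Rn N → Rn N :=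
  if h : ∃ G, IsWeakGradient Ω u G then h.choose else 0

/-- `u` represents an element of the Sobolev space `W^{1,r}(Ω)`. -/
structure MemW1 (r : ℝ) (Ω : Set (Rn N)) (u : Rn N → ℝ) : Prop where
  memLp : MemLp u (ENNReal.ofReal r) (volume.restrict Ω)
  exists_grad : ∃ G, IsWeakGradient Ω u G
  memLp_grad : MemLp (weakGrad Ω u) (ENNReal.ofReal r) (volume.restrict Ω)

/-- `g` is the trace on `∂Ω` of `u ∈ W^{1,r}(Ω)`: the trace operator is the continuous extension
to `W^{1,r}(Ω)`, with values in `L^r(∂Ω)`, of the restriction of smooth functions to `∂Ω`. -/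
structure IsTrace (r : ℝ) (Ω : Set (Rn N)) (u g : Rn N → ℝ) : Prop where
  memLp : MemLp g (ENNReal.ofReal r) (surfaceMeasure Ω)
  exists_approx : ∃ φ : ℕ → Rn N → ℝ, (∀ n, ContDiff ℝ ∞ (φ n)) ∧
    Tendsto (fun n => eLpNorm (φ n - u) (ENNReal.ofReal r) (volume.restrict Ω)) atTop (𝓝 0) ∧
    Tendsto (fun n => eLpNorm (∇ (φ n) - weakGrad Ω u) (ENNReal.ofReal r) (volume.restrict Ω))
      atTop (𝓝 0) ∧
    Tendsto (fun n => eLpNorm (φ n - g) (ENNReal.ofReal r) (surfaceMeasure Ω)) atTop (𝓝 0)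

/-- The nonzero elements of `𝒲_r = {u ∈ W^{1,r}(Ω) : ∫_Ω a u + ∫_{∂Ω} b u dσ = 0}`; the pair
`(u, g)` consists of a function and its trace on `∂Ω`. -/
def constraintSet (r : ℝ) (Ω : Set (Rn N)) (a b : Rn N → ℝ) :
    Set ((Rn N → ℝ) × (Rn N → ℝ)) :=
  {w | MemW1 r Ω w.1 ∧ IsTrace r Ω w.1 w.2 ∧
    (∫ x in Ω, a x * w.1 x) + ∫ x, b x * w.2 x ∂(surfaceMeasure Ω) = 0 ∧
    ¬ w.1 =ᵐ[volume.restrict Ω] 0}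

/-- The Dirichlet-type integral `∫_Ω |∇u|^q`. -/
def gradEnergy (q : ℝ) (Ω : Set (Rn N)) (u : Rn N → ℝ) : ℝ≥0∞ :=
  ∫⁻ x in Ω, ‖weakGrad Ω u x‖ₑ ^ q

/-- `(1/p ∫_Ω |∇u|^p + 1/2 ∫_Ω |∇u|²) / (1/2 ∫_Ω a u² + 1/2 ∫_{∂Ω} b g² dσ)`, with values in
`[0, ∞]`; a positive number divided by `0` is `∞`. -/
def quotientP2 (p : ℝ) (Ω : Set (Rn N)) (a b u g : Rn N → ℝ) : ℝ≥0∞ :=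
  (ENNReal.ofReal (1 / p) * gradEnergy p Ω u + ENNReal.ofReal (1 / 2) * gradEnergy 2 Ω u) /
    (ENNReal.ofReal (1 / 2) * (∫⁻ x in Ω, ENNReal.ofReal (a x * u x ^ 2)) +
      ENNReal.ofReal (1 / 2) * ∫⁻ x, ENNReal.ofReal (b x * g x ^ 2) ∂(surfaceMeasure Ω))

/-- `∫_Ω |∇u|² / (∫_Ω a u² + ∫_{∂Ω} b g² dσ)`, with values in `[0, ∞]`. -/
def quotient2 (Ω : Set (Rn N)) (a b u g : Rn N → ℝ) : ℝ≥0∞ :=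
  gradEnergy 2 Ω u /
    ((∫⁻ x in Ω, ENNReal.ofReal (a x * u x ^ 2)) +
      ∫⁻ x, ENNReal.ofReal (b x * g x ^ 2) ∂(surfaceMeasure Ω))

/-- `λ₁(p)`: infimum of `quotientP2 p` over `𝒲_p \ {0}`. -/
def lambda1 (p : ℝ) (Ω : Set (Rn N)) (a b : Rn N → ℝ) : ℝ≥0∞ :=
  ⨅ w ∈ constraintSet p Ω a b, quotientP2 p Ω a b w.1 w.2

/-- `μ₁(p)`: infimum of `quotientP2 p` over `𝒲_2 \ {0}`. -/
def mu1 (p : ℝ) (Ω : Set (Rn N)) (a b : Rn N → ℝ) : ℝ≥0∞ :=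
  ⨅ w ∈ constraintSet 2 Ω a b, quotientP2 p Ω a b w.1 w.2

/-- `ν₁(r)`: infimum of `quotient2` over `𝒲_r \ {0}`. -/
def nu1 (r : ℝ) (Ω : Set (Rn N)) (a b : Rn N → ℝ) : ℝ≥0∞ :=
  ⨅ w ∈ constraintSet r Ω a b, quotient2 Ω a b w.1 w.2

/-- The integrability conditions on the weights `a ≥ 0` and `b ≥ 0` in the case `1 < p < 2`. -/
def SubquadraticWeights (p : ℝ) (Ω : Set (Rn N)) (a b : Rn N → ℝ) : Prop :=
  (2 * N / (N + 1) < p ∧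
    MemLp a (ENNReal.ofReal (p * N / ((p - 2) * N + 2 * p))) (volume.restrict Ω) ∧
    MemLp b (ENNReal.ofReal (p * (N - 1) / ((p - 2) * N + p))) (surfaceMeasure Ω)) ∨
  (2 * N / (N + 2) < p ∧ p ≤ 2 * N / (N + 1) ∧
    MemLp a (ENNReal.ofReal (p * N / ((p - 2) * N + 2 * p))) (volume.restrict Ω) ∧
    MemLp b ∞ (surfaceMeasure Ω)) ∨
  (p ≤ 2 * N / (N + 2) ∧ MemLp a ∞ (volume.restrict Ω) ∧ MemLp b ∞ (surfaceMeasure Ω))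

end P2Laplacian

end

/-! The constraint set is a cone without its apex, and replacing `u` by `t • u` multiplies the
`p`-energy by `|t|^p` but the `2`-energy and the denominator by `t^2`. After cancelling `t^2 / 2`,
only the `p`-energy still carries a factor, `|t|^(p-2)`, which is made arbitrarily small by `t → 0`
if `p > 2` and by `t → ∞` if `p < 2`. So the `p`-energy, being finite, does not affect the infimum;
the reverse inequality just discards it. Both parts are instances of `iInf_quotientP2_eq_nu1`, with
`r = p` and with `r = 2 > p`. `quotientP2_const_smul` carries the scaling. -/

namespace P2Laplacian

section Scaling

variable {N : ℕ} {Ω : Set (Rn N)} {u g : Rn N → ℝ} {G G' : Rn N → Rn N}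

/-- A test function supported in `Ω` times a locally integrable function is integrable. -/
theorem integrable_smul_of_tsupport_subset (hG : LocallyIntegrableOn G Ω) {φ : Rn N → ℝ}
    (hφ : Continuous φ) (hc : HasCompactSupport φ) (hs : tsupport φ ⊆ Ω) :
    Integrable (fun x => φ x • G x) := by
  have h : IntegrableOn (fun x => φ x • G x) (tsupport φ) :=
    (hG.integrableOn_compact_subset hs hc).continuousOn_smul hφ.continuousOn hc
  refine (integrableOn_iff_integrable_of_support_subset ?_).1 h
  intro x hx
  refine subset_tsupport φ ?_
  simp only [Function.mem_support] at hx ⊢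
  exact fun h0 => hx (by simp [h0])

/-- Weak gradients on an open set are unique up to null sets. -/
theorem IsWeakGradient.ae_eq (hΩ : IsOpen Ω) (h : IsWeakGradient Ω u G)
    (h' : IsWeakGradient Ω u G') : G =ᵐ[volume.restrict Ω] G' := by
  have key : ∀ᵐ x, x ∈ Ω → (G - G') x = 0 := by
    refine hΩ.ae_eq_zero_of_integral_contDiff_smul_eq_zero
      (h.locallyIntegrable_grad.sub h'.locallyIntegrable_grad) fun φ hφ hc hs => ?_
    have hset : ∫ x, φ x • (G - G') x = ∫ x in Ω, φ x • (G - G') x := by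
      refine (setIntegral_eq_integral_of_forall_compl_eq_zero fun x hx => ?_).symm
      rw [image_eq_zero_of_notMem_tsupport fun hx' => hx (hs hx'), zero_smul]
    have hi := integrable_smul_of_tsupport_subset h.locallyIntegrable_grad hφ.continuous hc hs
    have hi' := integrable_smul_of_tsupport_subset h'.locallyIntegrable_grad hφ.continuous hc hs
    have e := (h.integral_eq φ hφ hc hs).symm.trans (h'.integral_eq φ hφ hc hs)
    rw [hset]
    simp only [Pi.sub_apply, smul_sub]
    rw [integral_sub hi.integrableOn hi'.integrableOn, sub_eq_zero]
    exact neg_injective e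
  rw [EventuallyEq, ae_restrict_iff' hΩ.measurableSet]
  filter_upwards [key] with x hx hxΩ
  exact sub_eq_zero.1 (hx hxΩ)

theorem IsWeakGradient.const_smul (h : IsWeakGradient Ω u G) (t : ℝ) :
    IsWeakGradient Ω (t • u) (t • G) where
  locallyIntegrable := h.locallyIntegrable.smul t
  locallyIntegrable_grad := h.locallyIntegrable_grad.smul t
  integral_eq φ hφ hc hs := by
    have e := h.integral_eq φ hφ hc hs
    simp only [Pi.smul_apply, smul_assoc, smul_comm _ t]
    rw [integral_smul, integral_smul, e, smul_neg]

theorem isWeakGradient_weakGrad (h : ∃ G, IsWeakGradient Ω u G) :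
    IsWeakGradient Ω u (weakGrad Ω u) := by
  rw [weakGrad, dif_pos h]
  exact h.choose_spec

/-- `weakGrad` is an arbitrary choice for each function, so homogeneity comes from uniqueness and
holds only almost everywhere. -/
theorem weakGrad_const_smul (hΩ : IsOpen Ω) (h : ∃ G, IsWeakGradient Ω u G) (t : ℝ) :
    weakGrad Ω (t • u) =ᵐ[volume.restrict Ω] t • weakGrad Ω u := by
  have hu := (isWeakGradient_weakGrad h).const_smul t
  exact (isWeakGradient_weakGrad ⟨_, hu⟩).ae_eq hΩ hu

theorem MemW1.const_smul (hΩ : IsOpen Ω) {r : ℝ} (h : MemW1 r Ω u) (t : ℝ) :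
    MemW1 r Ω (t • u) where
  memLp := h.memLp.const_smul t
  exists_grad := ⟨_, (isWeakGradient_weakGrad h.exists_grad).const_smul t⟩
  memLp_grad := (memLp_congr_ae (weakGrad_const_smul hΩ h.exists_grad t)).2
    (h.memLp_grad.const_smul t)

theorem gradient_const_smul {φ : Rn N → ℝ} (hφ : Differentiable ℝ φ) (t : ℝ) :
    ∇ (t • φ) = t • ∇ φ := by
  ext1 x
  simp only [gradient, Pi.smul_apply, fderiv_const_smul (hφ x), map_smulₛₗ, conj_trivial]

/-- Convergence in `L^r` is preserved under scaling. -/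
theorem tendsto_eLpNorm_const_smul_sub {α E : Type*} [MeasurableSpace α] [NormedAddCommGroup E]
    [NormedSpace ℝ E] {μ : Measure α} {q : ℝ≥0∞} {φ : ℕ → α → E} {f : α → E}
    (h : Tendsto (fun n => eLpNorm (φ n - f) q μ) atTop (𝓝 0)) (t : ℝ) :
    Tendsto (fun n => eLpNorm (t • φ n - t • f) q μ) atTop (𝓝 0) := by
  simp only [← smul_sub, eLpNorm_const_smul]
  simpa using ENNReal.Tendsto.const_mul h (Or.inr (enorm_ne_top (x := t)))

theorem IsTrace.const_smul (hΩ : IsOpen Ω) {r : ℝ} (hu : MemW1 r Ω u) (h : IsTrace r Ω u g)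
    (t : ℝ) : IsTrace r Ω (t • u) (t • g) where
  memLp := h.memLp.const_smul t
  exists_approx := by
    obtain ⟨φ, hφ, h1, h2, h3⟩ := h.exists_approx
    refine ⟨fun n => t • φ n, fun n => (hφ n).const_smul t, tendsto_eLpNorm_const_smul_sub h1 t,
      ?_, tendsto_eLpNorm_const_smul_sub h3 t⟩
    refine (tendsto_eLpNorm_const_smul_sub h2 t).congr fun n => eLpNorm_congr_ae ?_
    rw [gradient_const_smul ((hφ n).differentiable (by simp)) t]
    exact EventuallyEq.rfl.sub (weakGrad_const_smul hΩ hu.exists_grad t).symm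

theorem constraintSet_const_smul (hΩ : IsOpen Ω) {r : ℝ} {a b : Rn N → ℝ}
    {w : (Rn N → ℝ) × (Rn N → ℝ)} (hw : w ∈ constraintSet r Ω a b) {t : ℝ} (ht : t ≠ 0) :
    t • w ∈ constraintSet r Ω a b := by
  obtain ⟨h1, h2, h3, h4⟩ := hw
  refine ⟨h1.const_smul hΩ t, h2.const_smul hΩ h1 t, ?_, fun h0 => h4 ?_⟩
  · simp only [Prod.smul_fst, Prod.smul_snd, Pi.smul_apply, smul_eq_mul, mul_left_comm _ t,
      integral_const_mul, ← mul_add, h3, mul_zero]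
  · filter_upwards [h0] with x hx
    simpa [ht] using hx

theorem gradEnergy_const_smul (hΩ : IsOpen Ω) (h : ∃ G, IsWeakGradient Ω u G) {q : ℝ}
    (hq : 0 ≤ q) (t : ℝ) : gradEnergy q Ω (t • u) = ‖t‖ₑ ^ q * gradEnergy q Ω u := by
  rw [gradEnergy, gradEnergy,
    ← lintegral_const_mul' _ _ (ENNReal.rpow_ne_top_of_nonneg hq enorm_ne_top)]
  refine lintegral_congr_ae ?_
  filter_upwards [weakGrad_const_smul hΩ h t] with x hx
  rw [hx, Pi.smul_apply, enorm_smul, ENNReal.mul_rpow_of_nonneg _ _ hq]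

theorem lintegral_weight_const_smul (μ : Measure (Rn N)) (c f : Rn N → ℝ) (t : ℝ) :
    ∫⁻ x, ENNReal.ofReal (c x * (t • f) x ^ 2) ∂μ =
      ‖t‖ₑ ^ (2 : ℝ) * ∫⁻ x, ENNReal.ofReal (c x * f x ^ 2) ∂μ := by
  rw [← lintegral_const_mul' _ _ (ENNReal.rpow_ne_top_of_nonneg zero_le_two enorm_ne_top)]
  refine lintegral_congr fun x => ?_
  rw [ENNReal.rpow_two, ← enorm_pow, Real.enorm_of_nonneg (sq_nonneg t),
    ← ENNReal.ofReal_mul (sq_nonneg t)]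
  congr 1
  simp only [Pi.smul_apply, smul_eq_mul]
  ring

/-- Under scaling by `t`, only the `p`-energy in the quotient changes, by the factor `t^(p-2)`. -/
theorem quotientP2_const_smul (hΩ : IsOpen Ω) (h : ∃ G, IsWeakGradient Ω u G) {p : ℝ}
    (hp : 0 < p) (a b : Rn N → ℝ) {t : ℝ} (ht : t ≠ 0) :
    quotientP2 p Ω a b (t • u) (t • g) =
      (‖t‖ₑ ^ (p - 2) * (ENNReal.ofReal (2 / p) * gradEnergy p Ω u) + gradEnergy 2 Ω u) /
        ((∫⁻ x in Ω, ENNReal.ofReal (a x * u x ^ 2)) +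
          ∫⁻ x, ENNReal.ofReal (b x * g x ^ 2) ∂(surfaceMeasure Ω)) := by
  have ht0 : ‖t‖ₑ ≠ 0 := enorm_ne_zero.2 ht
  have hc0 : ENNReal.ofReal (1 / 2) * ‖t‖ₑ ^ (2 : ℝ) ≠ 0 :=
    mul_ne_zero (by simp) ((ENNReal.rpow_pos (pos_iff_ne_zero.2 ht0) enorm_ne_top).ne')
  have hct : ENNReal.ofReal (1 / 2) * ‖t‖ₑ ^ (2 : ℝ) ≠ ⊤ :=
    ENNReal.mul_ne_top ENNReal.ofReal_ne_top
      (ENNReal.rpow_ne_top_of_nonneg zero_le_two enorm_ne_top)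
  have hpow : ‖t‖ₑ ^ p = ‖t‖ₑ ^ (2 : ℝ) * ‖t‖ₑ ^ (p - 2) := by
    rw [← ENNReal.rpow_add _ _ ht0 enorm_ne_top]
    congr 1
    ring
  have hcoef : ENNReal.ofReal (1 / p) = ENNReal.ofReal (1 / 2) * ENNReal.ofReal (2 / p) := by
    rw [← ENNReal.ofReal_mul (by norm_num)]
    congr 1
    field_simp
  rw [quotientP2, gradEnergy_const_smul hΩ h hp.le, gradEnergy_const_smul hΩ h zero_le_two,
    lintegral_weight_const_smul, lintegral_weight_const_smul, hpow, hcoef]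
  refine Eq.trans ?_ (ENNReal.mul_div_mul_left _ _ hc0 hct)
  congr 1 <;> ring

theorem quotient2_le_quotientP2 (p : ℝ) (Ω : Set (Rn N)) (a b u g : Rn N → ℝ) :
    quotient2 Ω a b u g ≤ quotientP2 p Ω a b u g := by
  rw [quotient2, quotientP2, ← mul_add,
    ← ENNReal.mul_div_mul_left _ _ (c := ENNReal.ofReal (1 / 2)) (by simp) ENNReal.ofReal_ne_top]
  exact ENNReal.div_le_div_right le_add_self _

/-- Either energy vanishes exactly when the weak gradient is zero a.e. This settles the `0 / 0` case
below. -/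
theorem gradEnergy_eq_zero_of_gradEnergy_eq_zero {q p : ℝ} (hq : 0 < q) (hp : 0 < p)
    (hm : AEStronglyMeasurable (weakGrad Ω u) (volume.restrict Ω)) (h : gradEnergy q Ω u = 0) :
    gradEnergy p Ω u = 0 := by
  rw [gradEnergy, lintegral_eq_zero_iff' (hm.enorm.pow_const q)] at h
  rw [gradEnergy, lintegral_eq_zero_iff' (hm.enorm.pow_const p)]
  filter_upwards [h] with x hx
  have h0 : ‖weakGrad Ω u x‖ₑ = 0 := (ENNReal.rpow_eq_zero_iff_of_pos hq).1 hx
  simp [h0, hp]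

/-- On a set of finite measure `L^r ⊆ L^p` for `p ≤ r`. Finiteness lets a vanishing factor kill the
`p`-energy. -/
theorem MemW1.gradEnergy_ne_top (hΩ : Bornology.IsBounded Ω) {r p : ℝ} (h : MemW1 r Ω u)
    (hp : 0 < p) (hpr : p ≤ r) : gradEnergy p Ω u ≠ ⊤ := by
  have : IsFiniteMeasure (volume.restrict Ω) := ⟨by simpa using hΩ.measure_lt_top⟩
  have hm := h.memLp_grad.mono_exponent (ENNReal.ofReal_le_ofReal hpr)
  have := lintegral_rpow_enorm_lt_top_of_eLpNorm_lt_top (by simpa using hp)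
    ENNReal.ofReal_ne_top hm.eLpNorm_lt_top
  rw [ENNReal.toReal_ofReal hp.le] at this
  exact this.ne

/-- Over the cone `𝒲_r \ {0}`, with `p ≤ r` and `p ≠ 2`, the infima of the two quotients agree:
scaling makes the contribution of the `p`-energy arbitrarily small. -/
theorem iInf_quotientP2_eq_nu1 (hΩ : IsOpen Ω) (hb : Bornology.IsBounded Ω) {r p : ℝ}
    (hp : 0 < p) (hpr : p ≤ r) (hp2 : p ≠ 2) (a b : Rn N → ℝ) :
    ⨅ w ∈ constraintSet r Ω a b, quotientP2 p Ω a b w.1 w.2 = nu1 r Ω a b := by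
  refine le_antisymm (le_iInf₂ fun w hw => ?_)
    (iInf₂_mono fun w _ => quotient2_le_quotientP2 p Ω a b w.1 w.2)
  set E := ENNReal.ofReal (2 / p) * gradEnergy p Ω w.1 with hE
  have hEtop : E ≠ ⊤ :=
    ENNReal.mul_ne_top ENNReal.ofReal_ne_top (hw.1.gradEnergy_ne_top hb hp hpr)
  rw [quotient2]
  set D := (∫⁻ x in Ω, ENNReal.ofReal (a x * w.1 x ^ 2)) +
    ∫⁻ x, ENNReal.ofReal (b x * w.2 x ^ 2) ∂(surfaceMeasure Ω)
  have key : ∀ ε : ℝ≥0∞, ε ≠ 0 → ε ≠ ⊤ →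
      ⨅ w ∈ constraintSet r Ω a b, quotientP2 p Ω a b w.1 w.2 ≤
        (ε * E + gradEnergy 2 Ω w.1) / D := by
    intro ε h0 hT
    -- The scale is chosen so that `T ^ (p - 2) = ε`, which treats `p < 2` and `p > 2` at once.
    set T : ℝ≥0∞ := ε ^ (p - 2)⁻¹ with hTdef
    have hT0 : T ≠ 0 := (ENNReal.rpow_pos (pos_iff_ne_zero.2 h0) hT).ne'
    have hTT : T ≠ ⊤ := ENNReal.rpow_ne_top_of_ne_zero h0 hT
    have hnorm : ‖T.toReal‖ₑ = T := by
      rw [Real.enorm_of_nonneg ENNReal.toReal_nonneg, ENNReal.ofReal_toReal hTT]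
    have ht : T.toReal ≠ 0 := ENNReal.toReal_ne_zero.2 ⟨hT0, hTT⟩
    refine (iInf₂_le _ (constraintSet_const_smul hΩ hw ht)).trans_eq ?_
    rw [Prod.smul_fst, Prod.smul_snd, quotientP2_const_smul hΩ hw.1.exists_grad hp a b ht, hnorm,
      hTdef, ENNReal.rpow_inv_rpow (sub_ne_zero.2 hp2)]
  -- Dividing by `D` commutes with the limit `ε → 0` except at `0 / 0`, which is `0` in `ℝ≥0∞`,
  -- whereas `c / 0 = ∞` for `c > 0`. In that case the gradient vanishes a.e., so `E = 0` and no
  -- limit is needed.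
  by_cases hnz : gradEnergy 2 Ω w.1 ≠ 0 ∨ D ≠ 0
  · have hlim : Tendsto (fun ε : ℝ≥0∞ => (ε * E + gradEnergy 2 Ω w.1) / D) (𝓝[>] 0)
        (𝓝 (gradEnergy 2 Ω w.1 / D)) := by
      refine ENNReal.Tendsto.div_const ?_ hnz
      have h0 : Tendsto (fun ε : ℝ≥0∞ => ε * E) (𝓝[>] 0) (𝓝 (0 * E)) :=
        ENNReal.Tendsto.mul_const (tendsto_id.mono_left nhdsWithin_le_nhds) (Or.inr hEtop)
      simpa using h0.add_const (gradEnergy 2 Ω w.1)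
    refine ge_of_tendsto hlim ?_
    filter_upwards [self_mem_nhdsWithin,
      mem_nhdsWithin_of_mem_nhds (Iio_mem_nhds ENNReal.zero_lt_top)] with ε h0 hT
    exact key ε (ne_of_gt h0) (ne_of_lt hT)
  · push Not at hnz
    have hE0 : E = 0 := by
      rw [hE, gradEnergy_eq_zero_of_gradEnergy_eq_zero zero_lt_two hp
        hw.1.memLp_grad.aestronglyMeasurable hnz.1, mul_zero]
    simpa [hE0] using key 1 one_ne_zero ENNReal.one_ne_top

end Scaling

end P2Laplacian

theorem mainTheorem3 (N : ℕ) (hN : 2 < N) (Ω : Set (P2Laplacian.Rn N))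
    (hΩ : P2Laplacian.IsSmoothBoundedDomain Ω) (a b : P2Laplacian.Rn N → ℝ)
    (ha : ∀ᵐ x ∂(volume.restrict Ω), 0 ≤ a x)
    (hb : ∀ᵐ x ∂(P2Laplacian.surfaceMeasure Ω), 0 ≤ b x)
    (hab : 0 < (∫ x in Ω, a x) + ∫ x, b x ∂(P2Laplacian.surfaceMeasure Ω)) (p : ℝ) :
    (2 < p →
      MemLp a (ENNReal.ofReal ((N : ℝ) / 2)) (volume.restrict Ω) →
      MemLp b (ENNReal.ofReal ((N : ℝ) - 1)) (P2Laplacian.surfaceMeasure Ω) →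
      P2Laplacian.lambda1 p Ω a b = P2Laplacian.nu1 p Ω a b) ∧
    (1 < p → p < 2 → P2Laplacian.SubquadraticWeights p Ω a b →
      P2Laplacian.mu1 p Ω a b = P2Laplacian.nu1 2 Ω a b) := by
  have ho := hΩ.isOpen
  have hbd := hΩ.isBounded
  refine ⟨fun hp _ _ => ?_, fun hp hp2 _ => ?_⟩
  · exact P2Laplacian.iInf_quotientP2_eq_nu1 ho hbd (by linarith) le_rfl hp.ne' a b
  · exact P2Laplacian.iInf_quotientP2_eq_nu1 ho hbd (by linarith) hp2.le hp2.ne a b
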